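/- For vector spaces $V_1,\dots,V_k$ over $\mathbb{C}$ of finite dimension and $t\in V_1\otimes\cdots\otimes V_k$, let the tensor rank $\mathrm{R}(t)$ be the smallest $r$ such that $t$ is a sum of $r$ simple tensors $v_1\otimes\cdots\otimes v_k$ with $v_i\in V_i$, and let the border rank $\underline{\mathrm{R}}(t)$ be the smallest $r$ such that $t$ lies in the closure, in the Euclidean topology, of the set of tensors of rank at most $r$. For a graph $G=(V,E)$ and a natural number $n$, let $b_1,\dots,b_n$ be the standard basis of $\mathbb{C}^n$ and let $$\mathrm{T}_n(G)=\sum_{i\in\{1,\dots,n\}^E}\ \bigotimes_{v\in V}\Bigl(\bigotimes_{e\in E:\,v\in e} b_{i_e}\Bigr),$$ regarded as a $|V|$-tensor with one leg $\bigotimes_{e\ni v}\mathbb{C}^n$ for each vertex $v$. Let $C_5$ be the cycle graph on five vertices, so that $\mathrm{T}_4(C_5)\in(\mathbb{C}^4\otimes\mathbb{C}^4)^{\otimes 5}$. **Proposition.** $\mathrm{R}(\mathrm{T}_4(C_5))\le 937<31^2$ and $\underline{\mathrm{R}}(\mathrm{T}_4(C_5))\le 910$. -/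

import Mathlib

open scoped TensorProduct

/-- The tensor rank of `t ∈ ⨂ᵢ Vᵢ` (complex vector spaces): the smallest `r` such that `t` is a sum
of `r` simple tensors `w₁ ⊗ ⋯ ⊗ wₖ` with `wᵢ ∈ Vᵢ`. The value is `⊤` if there is no such `r`. -/
noncomputable def tensorRank {ι : Type*} {V : ι → Type*} [∀ i, AddCommGroup (V i)]
    [∀ i, Module ℂ (V i)] (t : ⨂[ℂ] i, V i) : ℕ∞ :=
  ⨅ r ∈ {r : ℕ | ∃ w : Fin r → ∀ i, V i, t = ∑ j, PiTensorProduct.tprod ℂ (w j)}, (r : ℕ∞)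

/-- The border rank of `t ∈ ⨂ᵢ Vᵢ`: the smallest `r` such that `t` lies in the closure of the set
of tensors of rank at most `r`. The closure is taken in the canonical topology of the complex
vector space `⨂ᵢ Vᵢ` (the module topology), which on a finite-dimensional space is the Euclidean
topology. -/
noncomputable def tensorBorderRank {ι : Type*} {V : ι → Type*} [∀ i, AddCommGroup (V i)]
    [∀ i, Module ℂ (V i)] (t : ⨂[ℂ] i, V i) : ℕ∞ :=
  ⨅ r ∈ {r : ℕ | t ∈ @closure (⨂[ℂ] i, V i) (moduleTopology ℂ (⨂[ℂ] i, V i))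
      {s : ⨂[ℂ] i, V i | tensorRank s ≤ r}}, (r : ℕ∞)

/-- The tensor leg of the graph tensor at the vertex `v`: the tensor product of one copy of `ℂⁿ`
for each edge `e` with `v ∈ e`. -/
abbrev GraphTensorLeg {V : Type*} (G : SimpleGraph V) (n : ℕ) (v : V) : Type _ :=
  ⨂[ℂ] _e : {e : G.edgeSet // v ∈ (e : Sym2 V)}, (Fin n → ℂ)

/-- The graph tensor `T_n(G) = ∑_{i ∈ [n]^E} ⨂_{v ∈ V} (⨂_{e ∋ v} b_{i_e})`, where `b` is the
standard basis of `ℂⁿ`; it is a tensor with one leg for each vertex of `G`. -/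
noncomputable def graphTensor {V : Type*} [DecidableEq V] (G : SimpleGraph V) [Fintype G.edgeSet]
    (n : ℕ) : ⨂[ℂ] v, GraphTensorLeg G n v :=
  ∑ i : G.edgeSet → Fin n,
    PiTensorProduct.tprod ℂ fun v : V =>
      (PiTensorProduct.tprod ℂ fun e : {e : G.edgeSet // v ∈ (e : Sym2 V)} =>
        (Pi.single (i e.1) 1 : Fin n → ℂ) : GraphTensorLeg G n v)

/-!
The tensor of the five-cycle is that of the trace `tr (A B C D E)` of a product of five matrices,
with one leg for each matrix. The one with edge labels in `Fin 4` is the Kronecker square of the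
one with labels in `Fin 2`, so both bounds come from `2 × 2` matrices. Tensors are handled through
their coefficient arrays (`HasRankLE`, `HasBorderRankLE`), and `tensorOfArray` carries the bounds
back to the tensor product.

*Rank.* Write Strassen's algorithm for `tr (A B M)` as six products whose three factors are rank-one
linear forms, plus `tr A * tr B * tr M` (`strassen_decomposition`). Substituting `M = C D E`, each
of the six products becomes a sum of `4` simple tensors, as only the two edges inside `C D E` are
summed over (`splitTerm_hasRankLE`), and the product of traces needs `7`, by Strassen again
(`traceTerm_hasRankLE`). In the Kronecker square, the products of two terms of the first kind give
`24 ^ 2`, the square of the last term gives `7 ^ 2`, and each of the `12` mixed products is a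
disguised multiplication of a `2 × 4` by a `4 × 4` matrix, of rank at most `26`
(`rectMul_decomposition`, `splitTerm_mul_traceTerm_hasRankLE`). The total is
`576 + 12 * 26 + 49 = 937`.

*Border rank.* Conjugating all matrices by `diag (1, ε)` fixes `tr (A B C D E)` and scales the
matrix units `E₀₁` and `E₁₀` by `ε⁻¹` and `ε`. An array which agrees with that of the trace wherever
`E₀₁` occurs at least as often as `E₁₀` therefore degenerates to it under this torus as `ε → 0`.
There is such an array of rank `29` (`borderArray`, `borderArray_eq`): a sum of five orbits of
cyclic rotations and four fifth powers. So the five-cycle with two labels has border rank at most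
`29`, and its square at most `29 ^ 2 = 841`.
-/

open Filter Topology

/-! ### Coefficient arrays and their rank -/

/-- The array `f : (ι → X) → R`, read as the coefficients of a tensor with one leg `X → R` for
each element of `ι`, is a sum of `r` arrays of the form `a ↦ ∏ i, w i (a i)`. -/
def HasRankLE {ι X R : Type*} [Fintype ι] [CommSemiring R] (f : (ι → X) → R) (r : ℕ) : Prop :=
  ∃ w : Fin r → ι → X → R, ∀ a, f a = ∑ j, ∏ i, w j i (a i)

namespace HasRankLE

variable {ι X Y R S : Type*} [Fintype ι] [CommSemiring R] [CommSemiring S]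

theorem of_fintype {κ : Type*} [Fintype κ] {f : (ι → X) → R} {r : ℕ} (w : κ → ι → X → R)
    (hr : Fintype.card κ = r) (h : ∀ a, f a = ∑ j, ∏ i, w j i (a i)) : HasRankLE f r := by
  let e := Fintype.equivFinOfCardEq hr
  refine ⟨fun j => w (e.symm j), fun a => ?_⟩
  rw [h a]
  exact (Equiv.sum_comp e.symm fun j => ∏ i, w j i (a i)).symm

theorem add {f g : (ι → X) → R} {r s : ℕ} (hf : HasRankLE f r) (hg : HasRankLE g s) :
    HasRankLE (fun a => f a + g a) (r + s) := by
  obtain ⟨w, hw⟩ := hf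
  obtain ⟨w', hw'⟩ := hg
  refine of_fintype (Sum.elim w w') (by simp) fun a => ?_
  simp [hw, hw']

theorem sum {κ : Type*} [Fintype κ] {f : κ → (ι → X) → R} {r : ℕ} (hf : ∀ k, HasRankLE (f k) r) :
    HasRankLE (fun a => ∑ k, f k a) (Fintype.card κ * r) := by
  choose w hw using hf
  refine of_fintype (fun p : κ × Fin r => w p.1 p.2) (by simp) fun a => ?_
  simp [hw, Fintype.sum_prod_type]

/-- Rank is submultiplicative under the Kronecker product. -/
theorem mul {f : (ι → X) → R} {g : (ι → Y) → R} {r s : ℕ} (hf : HasRankLE f r)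
    (hg : HasRankLE g s) :
    HasRankLE (fun a : ι → X × Y => f (fun i => (a i).1) * g (fun i => (a i).2)) (r * s) := by
  obtain ⟨w, hw⟩ := hf
  obtain ⟨w', hw'⟩ := hg
  refine of_fintype (fun (p : Fin r × Fin s) i x => w p.1 i x.1 * w' p.2 i x.2) (by simp)
    fun a => ?_
  simp [hw, hw', Fintype.sum_prod_type, Finset.sum_mul_sum, Finset.prod_mul_distrib]

theorem comp {f : (ι → X) → R} {r : ℕ} (hf : HasRankLE f r) (φ : Y → X) :
    HasRankLE (fun a : ι → Y => f (fun i => φ (a i))) r := by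
  obtain ⟨w, hw⟩ := hf
  exact ⟨fun j i y => w j i (φ y), fun a => hw _⟩

theorem map {f : (ι → X) → R} {r : ℕ} (hf : HasRankLE f r) (φ : R →+* S) :
    HasRankLE (fun a => φ (f a)) r := by
  obtain ⟨w, hw⟩ := hf
  exact ⟨fun j i x => φ (w j i x), fun a => by simp [hw]⟩

/-- Rescaling the basis vectors of every leg does not increase the rank. -/
theorem prod_mul {f : (ι → X) → R} {r : ℕ} (hf : HasRankLE f r) (u : X → R) :
    HasRankLE (fun a => (∏ i, u (a i)) * f a) r := by
  obtain ⟨w, hw⟩ := hf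
  exact ⟨fun j i x => u x * w j i x, fun a => by
    simp [hw, Finset.prod_mul_distrib, Finset.mul_sum]⟩

end HasRankLE

/-- The array `f` is a pointwise limit of arrays of rank at most `r`. -/
def HasBorderRankLE {ι X : Type*} [Fintype ι] (f : (ι → X) → ℂ) (r : ℕ) : Prop :=
  ∃ F : ℕ → (ι → X) → ℂ, (∀ k, HasRankLE (F k) r) ∧ ∀ a, Tendsto (fun k => F k a) atTop (𝓝 (f a))

namespace HasBorderRankLE

variable {ι X Y : Type*} [Fintype ι]

theorem mul {f : (ι → X) → ℂ} {g : (ι → Y) → ℂ} {r s : ℕ} (hf : HasBorderRankLE f r)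
    (hg : HasBorderRankLE g s) :
    HasBorderRankLE (fun a : ι → X × Y => f (fun i => (a i).1) * g (fun i => (a i).2))
      (r * s) := by
  obtain ⟨F, hF, hF'⟩ := hf
  obtain ⟨G, hG, hG'⟩ := hg
  exact ⟨fun k a => F k (fun i => (a i).1) * G k (fun i => (a i).2), fun k => (hF k).mul (hG k),
    fun a => (hF' _).mul (hG' _)⟩

theorem comp {f : (ι → X) → ℂ} {r : ℕ} (hf : HasBorderRankLE f r) (φ : Y → X) :
    HasBorderRankLE (fun a : ι → Y => f (fun i => φ (a i))) r := by
  obtain ⟨F, hF, hF'⟩ := hf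
  exact ⟨fun k a => F k fun i => φ (a i), fun k => (hF k).comp φ, fun a => hF' _⟩

end HasBorderRankLE

/-! ### From arrays to tensors -/

section ofArray

variable {ι X : Type*} [Fintype ι] [DecidableEq ι] [Fintype X] {W : ι → Type*}
  [∀ i, AddCommGroup (W i)] [∀ i, Module ℂ (W i)]

/-- The tensor `∑ a, f a • ⨂ i, B i (a i)` with coefficient array `f` with respect to the
families of vectors `B i : X → W i`. -/
noncomputable def tensorOfArray (B : ∀ i, X → W i) : ((ι → X) → ℂ) →ₗ[ℂ] ⨂[ℂ] i, W i :=
  ∑ a : ι → X, (LinearMap.proj a).smulRight (PiTensorProduct.tprod ℂ fun i => B i (a i))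

theorem tensorOfArray_apply (B : ∀ i, X → W i) (f : (ι → X) → ℂ) :
    tensorOfArray B f = ∑ a, f a • PiTensorProduct.tprod ℂ fun i => B i (a i) := by
  simp [tensorOfArray]

theorem HasRankLE.tensorRank_le {f : (ι → X) → ℂ} {r : ℕ} (hf : HasRankLE f r)
    (B : ∀ i, X → W i) : tensorRank (tensorOfArray B f) ≤ r := by
  obtain ⟨w, hw⟩ := hf
  refine iInf₂_le r ⟨fun j i => ∑ x, w j i x • B i x, ?_⟩
  simp only [MultilinearMap.map_sum, MultilinearMap.map_smul_univ, tensorOfArray_apply, hw,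
    Finset.sum_smul]
  exact Finset.sum_comm

theorem HasBorderRankLE.tensorBorderRank_le {f : (ι → X) → ℂ} {r : ℕ} (hf : HasBorderRankLE f r)
    (B : ∀ i, X → W i) : tensorBorderRank (tensorOfArray B f) ≤ r := by
  obtain ⟨F, hF, hlim⟩ := hf
  refine iInf₂_le r ?_
  let _ : TopologicalSpace (⨂[ℂ] i, W i) := moduleTopology ℂ _
  have : IsModuleTopology ℂ (⨂[ℂ] i, W i) := ⟨rfl⟩
  have : ContinuousAdd (⨂[ℂ] i, W i) := IsModuleTopology.toContinuousAdd ℂ _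
  have : ContinuousSMul ℂ (⨂[ℂ] i, W i) := IsModuleTopology.toContinuousSMul ℂ _
  have hcont : Continuous (tensorOfArray B) :=
    IsModuleTopology.continuous_of_linearMap (tensorOfArray B)
  exact mem_closure_of_tendsto ((hcont.tendsto f).comp (tendsto_pi_nhds.2 hlim))
    (Eventually.of_forall fun k => (hF k).tensorRank_le B)

end ofArray

/-! ### The graph tensor of the five-cycle -/

/-- The coefficient array of the tensor of the five-cycle with edge labels in `X`. A position
`a v = (x, y)` of the leg at `v` is a pair of labels for the edges `{v - 1, v}` and `{v, v + 1}`;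
the entry is `1` if the two labels of every edge agree and `0` otherwise. -/
def cycleArray (X R : Type*) [DecidableEq X] [CommSemiring R] (a : Fin 5 → X × X) : R :=
  ∏ v, if (a v).2 = (a (v + 1)).1 then 1 else 0

/-- The edge `{v - 1, v}` of the five-cycle. -/
def cycleEdge (v : Fin 5) : (SimpleGraph.cycleGraph 5).edgeSet :=
  ⟨s(v - 1, v), by revert v; simp [SimpleGraph.cycleGraph_adj]⟩

theorem cycleEdge_injective : Function.Injective cycleEdge := by
  have h : ∀ v w : Fin 5, s(v - 1, v) = s(w - 1, w) → v = w := by decide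
  exact fun v w hvw => h v w (congrArg Subtype.val hvw)

theorem exists_cycleEdge_eq (e : (SimpleGraph.cycleGraph 5).edgeSet) (v : Fin 5)
    (hv : v ∈ (e : Sym2 (Fin 5))) : e = cycleEdge v ∨ e = cycleEdge (v + 1) := by
  obtain ⟨e, he⟩ := e
  obtain ⟨w, rfl⟩ := Sym2.mem_iff_exists.1 hv
  rw [SimpleGraph.mem_edgeSet, SimpleGraph.cycleGraph_adj] at he
  rcases he with h | h
  · left
    obtain rfl : w = v - 1 := by rw [← h]; abel
    exact Subtype.ext Sym2.eq_swap
  · right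
    obtain rfl : w = v + 1 := by rw [← h]; abel
    exact Subtype.ext (by simp [cycleEdge])

theorem cycleEdge_bijective : Function.Bijective cycleEdge := by
  refine ⟨cycleEdge_injective, fun e => ?_⟩
  obtain ⟨v, hv⟩ : ∃ v, v ∈ (e : Sym2 (Fin 5)) := by
    obtain ⟨e, he⟩ := e
    induction e with
    | h v w => exact ⟨v, Sym2.mem_mk_left v w⟩
  rcases exists_cycleEdge_eq e v hv with h | h
  exacts [⟨v, h.symm⟩, ⟨v + 1, h.symm⟩]

/-- The basis vector of the leg at `v` with label `x.1` on the edge `{v - 1, v}` and label `x.2`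
on the edge `{v, v + 1}`. -/
noncomputable def cycleLegVector (n : ℕ) (v : Fin 5) (x : Fin n × Fin n) :
    GraphTensorLeg (SimpleGraph.cycleGraph 5) n v :=
  PiTensorProduct.tprod ℂ fun e => Pi.single (if e.1 = cycleEdge v then x.1 else x.2) 1

theorem sum_cycleArray_smul {X M : Type*} [Fintype X] [DecidableEq X] [AddCommMonoid M] [Module ℂ M]
    (G : (Fin 5 → X × X) → M) :
    ∑ a, cycleArray X ℂ a • G a = ∑ i : Fin 5 → X, G fun v => (i v, i (v + 1)) := by
  symm
  refine Finset.sum_of_injOn (fun i v => (i v, i (v + 1))) ?_ (by simp) ?_ ?_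
  · intro i _ j _ h
    funext v
    exact congrArg Prod.fst (congrFun h v)
  · intro a _ ha
    have : ∃ v, (a v).2 ≠ (a (v + 1)).1 := by
      by_contra! hall
      refine ha ⟨fun v => (a v).1, by simp, ?_⟩
      funext v
      exact Prod.ext rfl (hall v).symm
    obtain ⟨v, hv⟩ := this
    have h0 : cycleArray X ℂ a = 0 :=
      Finset.prod_eq_zero (Finset.mem_univ v) (if_neg hv)
    rw [h0, zero_smul]
  · intro i _
    simp [cycleArray]

theorem graphTensor_cycleGraph_five (n : ℕ) :
    graphTensor (SimpleGraph.cycleGraph 5) n =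
      tensorOfArray (cycleLegVector n) (cycleArray (Fin n) ℂ) := by
  rw [tensorOfArray_apply, sum_cycleArray_smul, graphTensor]
  let E := Equiv.ofBijective cycleEdge cycleEdge_bijective
  refine Fintype.sum_equiv (Equiv.arrowCongr E.symm (Equiv.refl (Fin n))) _ _ fun i => ?_
  congr 1
  funext v
  rw [cycleLegVector]
  congr 1
  funext e
  change Pi.single (i e.1) 1 =
    Pi.single (if e.1 = cycleEdge v then i (cycleEdge v) else i (cycleEdge (v + 1))) 1
  rcases exists_cycleEdge_eq e.1 v e.2 with h | h
  · rw [if_pos h, h]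
  · have hne : e.1 ≠ cycleEdge v := by
      rw [h]
      intro h'
      exact absurd (cycleEdge_injective h') (by simp)
    rw [if_neg hne, h]

theorem cycleArray_prod {X Y R : Type*} [DecidableEq X] [DecidableEq Y] [CommSemiring R]
    (a : Fin 5 → (X × Y) × (X × Y)) :
    cycleArray (X × Y) R a =
      cycleArray X R (fun v => ((a v).1.1, (a v).2.1)) *
        cycleArray Y R (fun v => ((a v).1.2, (a v).2.2)) := by
  simp only [cycleArray, ← Finset.prod_mul_distrib, Prod.ext_iff, ite_and, mul_ite, mul_one,
    mul_zero]
  refine Finset.prod_congr rfl fun v _ => ?_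
  split_ifs <;> rfl

theorem cycleArray_comp {X Y R : Type*} [DecidableEq X] [DecidableEq Y] [CommSemiring R]
    (e : X ≃ Y) (a : Fin 5 → X × X) :
    cycleArray Y R (fun v => (e (a v).1, e (a v).2)) = cycleArray X R a := by
  simp [cycleArray]

/-! ### Rank of the tensor of two-by-four by four-by-four matrix multiplication -/

/-- The first factors of `26` simple tensors adding up to the `2 × 4` by `4 × 4` matrix
multiplication tensor, as coefficient matrices of linear forms; see `rectMul_decomposition`. -/
def rectMulFst : Fin 26 → Matrix (Fin 2) (Fin 4) ℤ :=
  ![!![0, 0, 0, 0; 0, 0, 0, 1],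
    !![0, 1, 0, 0; 0, 1, 0, 0],
    !![0, 0, 0, 1; 0, 0, 0, 1],
    !![0, 1, 0, 0; 0, 0, 0, 0],
    !![0, 0, 0, 0; 1, 0, 0, 1],
    !![0, 1, 1, 0; 0, 0, 0, 0],
    !![1, 0, 0, 0; 0, 0, 0, -1],
    !![1, 0, 0, 1; 0, 0, 0, 0],
    !![1, 0, -1, 1; 0, 0, 0, 0],
    !![0, 0, 0, 0; 0, 1, 1, 0],
    !![0, 1, 0, 0; -1, 1, 1, 0],
    !![0, 0, 1, 0; 0, 0, 1, 0],
    !![1, 0, -1, 1; 1, 0, -1, 1],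
    !![1, 0, -1, 0; 0, 0, 0, 0],
    !![0, 0, 0, 0; 1, 0, -1, 0],
    !![1, 0, -1, 1; 0, 0, -1, 0],
    !![1, 1, 0, 1; 1, 1, 0, 1],
    !![0, 0, 0, 0; 1, 1, 0, 1],
    !![0, 1, 0, 0; 1, 1, 0, 1],
    !![0, 0, 0, 0; 1, -1, -1, 0],
    !![1, -1, -1, 0; 1, -1, -1, 0],
    !![1, 0, 0, 0; 1, 0, 0, 0],
    !![1, 0, 0, 0; 1, -1, -1, 0],
    !![0, 0, 0, 0; 0, 0, 1, 0],
    !![1, 0, 0, 0; 0, 0, 1, 0],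
    !![1, 0, 0, 0; 0, 0, 0, 0]]

/-- The second factors in `rectMul_decomposition`. -/
def rectMulSnd : Fin 26 → Matrix (Fin 4) (Fin 4) ℤ :=
  ![!![1, 0, 0, 0; 0, 0, 0, 0; 0, 0, 0, 0; -1, 0, 0, 0],
    !![0, 0, 0, 0; 0, 0, 1, 0; 0, 0, -1, 0; 0, 0, -1, 0],
    !![0, 0, 0, 0; 0, 0, 0, 0; 0, 0, 0, 0; 1, -1, 0, 1],
    !![0, 0, 0, 0; 1, 1, 1, 0; 0, 0, 0, 0; 0, 0, 0, 0],
    !![1, 0, 0, 0; -1, 0, 0, 0; 0, 0, 0, 0; 0, -1, 0, 0],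
    !![0, 0, 0, 0; 1, 0, 0, 1; 0, 0, 0, 0; 0, 0, 0, 0],
    !![1, 0, 0, 0; 0, 0, 0, 0; 0, 0, 0, 0; 0, -1, 0, 1],
    !![0, 0, 0, 0; 0, 0, 0, 0; 1, 0, 0, 0; 0, 1, 1, -1],
    !![0, 0, 0, 0; 0, 0, 0, 0; 1, 0, 0, 0; 0, 0, 0, 0],
    !![0, 0, 1, 0; 0, 0, 0, 0; 0, 0, 1, 0; 0, 0, -1, 0],
    !![0, 0, 0, 0; 0, 1, 0, 0; 0, 0, 1, 0; 0, 0, 0, 0],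
    !![0, 0, 0, 0; 1, 0, 0, 1; -1, 0, 0, -1; 0, -1, 0, 0],
    !![0, 0, 0, 0; 0, 0, 0, 0; 0, 0, 0, 0; 0, 1, 0, 0],
    !![0, 0, 0, 0; 1, 0, 0, 1; -1, 1, 1, -1; 0, 0, 0, 0],
    !![0, 1, 1, 0; 0, 1, 0, 0; 0, 0, 1, 0; 0, -1, -1, 0],
    !![0, 0, 0, 0; 0, 0, 0, 0; 1, 0, 0, 0; 0, 1, 0, 0],
    !![0, 0, 0, 0; 0, 0, 0, 0; 0, 0, 0, 0; 0, 0, 1, 0],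
    !![0, 0, 0, 0; 1, 0, 0, 0; 0, 0, 0, 0; 0, 0, 0, 0],
    !![0, 0, 0, 0; 1, 0, 0, 0; 0, 0, 0, 0; 0, 0, 1, 0],
    !![0, 0, 1, 0; 0, 1, 0, 0; 0, 0, 1, 0; 0, 0, -1, 0],
    !![0, 0, 0, 0; 1, 0, 0, 1; 0, 0, -1, 0; 0, 0, 0, 0],
    !![1, 0, -1, 1; 1, 0, 0, 1; 0, 0, -1, 0; 0, -1, 1, 0],
    !![0, 0, 1, 0; -1, 0, 0, -1; 0, 0, 1, 0; 0, 0, -1, 0],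
    !![0, 1, 1, 0; 0, 0, 0, 0; -1, 1, 1, 0; 0, -1, -1, 0],
    !![0, 1, 1, 0; 1, 0, 0, 1; -1, 1, 1, -1; 0, -1, -1, 0],
    !![0, 1, 1, -1; 1, 0, 0, 1; -1, 1, 1, -1; 0, -1, -1, 1]]

/-- The third factors in `rectMul_decomposition`. -/
def rectMulTrd : Fin 26 → Matrix (Fin 4) (Fin 2) ℤ :=
  ![!![1, -1; 0, 0; 0, 0; 0, 0],
    !![0, 0; 0, 0; 0, 1; 0, 0],
    !![1, 0; 0, 0; 0, 0; 0, 0],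
    !![0, 0; 0, 0; 1, -1; 0, 0],
    !![0, 1; 0, 0; 0, 0; 0, -1],
    !![0, 0; -1, 0; 1, 0; 1, 0],
    !![1, 0; 0, 0; 0, 0; 0, -1],
    !![1, 0; 0, 0; 0, 0; -1, 0],
    !![-1, 1; -1, 1; 0, 0; 0, 0],
    !![0, 0; 0, -1; 0, 1; 0, 1],
    !![0, 0; 1, 0; -1, 1; 0, 0],
    !![0, 0; -1, 0; 0, 0; -1, 0],
    !![0, 1; 0, 1; 0, 0; 0, 0],
    !![0, 0; -1, 0; 0, 0; 0, 0],
    !![0, 0; 0, 1; 0, 0; 0, 0],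
    !![0, -1; 1, -1; 0, 0; 1, 0],
    !![-1, 0; 0, 0; 1, 0; 1, 0],
    !![-1, 1; 0, 0; 1, -1; 1, -1],
    !![1, 0; 0, 0; -1, 1; -1, 0],
    !![0, 0; 1, -1; -1, 1; 0, 0],
    !![0, 0; -1, 0; 1, 0; 0, 0],
    !![0, 0; 0, 0; 0, 0; 0, 1],
    !![0, 0; -1, 0; 1, 0; 0, 1],
    !![0, 0; -1, 1; 0, 0; -1, 1],
    !![0, 0; 1, 0; 0, 0; 1, -1],
    !![0, 0; 0, 0; 0, 0; -1, 1]]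

theorem rectMul_decomposition (i i' : Fin 2) (j j' k k' : Fin 4) :
    (if i' = i then 1 else 0) * (if j = j' then 1 else 0) * (if k = k' then 1 else 0) =
      ∑ q, rectMulFst q i j * rectMulSnd q j' k * rectMulTrd q k' i' := by
  revert i i' j j' k k'
  decide +kernel

/-! ### Splitting the third factor of Strassen's algorithm -/

/-- The first factors of the six rank-one products in Strassen's algorithm. -/
def strassenFst : Fin 6 → Matrix (Fin 2) (Fin 2) ℤ :=
  ![!![0, 0; 1, 1], !![1, 0; 0, 0], !![0, 0; 0, 1], !![1, 1; 0, 0], !![-1, 0; 1, 0],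
    !![0, 1; 0, -1]]

/-- The second factors of the six rank-one products in Strassen's algorithm. -/
def strassenSnd : Fin 6 → Matrix (Fin 2) (Fin 2) ℤ :=
  ![!![1, 0; 0, 0], !![0, 1; 0, -1], !![-1, 0; 1, 0], !![0, 0; 0, 1], !![1, 1; 0, 0],
    !![0, 0; 1, 1]]

/-- The third factors of the six rank-one products in Strassen's algorithm are the rank-one
matrices with entries `strassenRow p i * strassenCol p j`. -/
def strassenRow : Fin 6 → Fin 2 → ℤ := ![![1, -1], ![0, 1], ![1, 0], ![-1, 1], ![0, 1], ![1, 0]]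

/-- The column vectors of the third factors in Strassen's algorithm; see `strassenRow`. -/
def strassenCol : Fin 6 → Fin 2 → ℤ := ![![0, 1], ![1, 1], ![1, 1], ![1, 0], ![0, 1], ![1, 0]]

/-- Strassen's algorithm: six products of rank-one linear forms and one product of three
traces. -/
theorem strassen_decomposition (a b c : Fin 2 × Fin 2) :
    ((if a.2 = b.1 then 1 else 0) * (if b.2 = c.1 then 1 else 0) *
      (if c.2 = a.1 then 1 else 0) : ℤ) =
      (∑ p, strassenFst p a.1 a.2 * strassenSnd p b.1 b.2 *
        (strassenRow p c.1 * strassenCol p c.2)) +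
      (if a.1 = a.2 then 1 else 0) * (if b.1 = b.2 then 1 else 0) *
        (if c.1 = c.2 then 1 else 0) := by
  revert a b c
  decide +kernel

/-- The contribution of the `p`-th rank-one product of Strassen's algorithm for `tr (A B M)` after
the substitution `M = C D E`. -/
def splitTerm (p : Fin 6) (a : Fin 5 → Fin 2 × Fin 2) : ℤ :=
  strassenFst p (a 0).1 (a 0).2 * strassenSnd p (a 1).1 (a 1).2 *
    (strassenRow p (a 2).1 * (if (a 2).2 = (a 3).1 then 1 else 0) *
      (if (a 3).2 = (a 4).1 then 1 else 0) * strassenCol p (a 4).2)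

/-- The contribution `tr A * tr B * tr (C D E)` of the product of three traces in Strassen's
algorithm for `tr (A B M)` after the substitution `M = C D E`. -/
def traceTerm (a : Fin 5 → Fin 2 × Fin 2) : ℤ :=
  (if (a 0).1 = (a 0).2 then 1 else 0) * (if (a 1).1 = (a 1).2 then 1 else 0) *
    ((if (a 2).2 = (a 3).1 then 1 else 0) * (if (a 3).2 = (a 4).1 then 1 else 0) *
      (if (a 4).2 = (a 2).1 then 1 else 0))

theorem cycleArray_two_eq (a : Fin 5 → Fin 2 × Fin 2) :
    cycleArray (Fin 2) ℤ a = (∑ p, splitTerm p a) + traceTerm a := by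
  have h := congrArg
    (· * ((if (a 2).2 = (a 3).1 then 1 else 0) * (if (a 3).2 = (a 4).1 then 1 else 0) : ℤ))
    (strassen_decomposition (a 0) (a 1) ((a 2).1, (a 4).2))
  simp only [add_mul, Finset.sum_mul] at h
  rw [cycleArray, Fin.prod_univ_five]
  refine Eq.trans ?_ (h.trans (congrArg₂ _ (Finset.sum_congr rfl fun p _ => ?_) ?_))
  · change (if (a 0).2 = (a 1).1 then 1 else 0) * (if (a 1).2 = (a 2).1 then 1 else 0) *
      (if (a 2).2 = (a 3).1 then 1 else 0) * (if (a 3).2 = (a 4).1 then 1 else 0) *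
      (if (a 4).2 = (a 0).1 then 1 else 0) = _
    ring
  · rw [splitTerm]
    ring
  · simp only [traceTerm, eq_comm (a := (a 2).1)]
    ring

/-- A split rank-one product needs only the four terms indexed by the labels of the two edges
inside `C D E`. -/
theorem splitTerm_hasRankLE (p : Fin 6) : HasRankLE (splitTerm p) 4 := by
  refine .of_fintype (κ := Fin 2 × Fin 2)
    (fun s => ![fun x => strassenFst p x.1 x.2, fun x => strassenSnd p x.1 x.2,
      fun x => strassenRow p x.1 * (if x.2 = s.1 then 1 else 0),
      fun x => if x = s then 1 else 0,
      fun x => (if s.2 = x.1 then 1 else 0) * strassenCol p x.2]) (by simp) fun a => ?_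
  rw [Finset.sum_eq_single (a 3)]
  · simp only [Fin.prod_univ_five, Matrix.cons_val, splitTerm, if_true]
    ring
  · intro s _ hs
    refine Finset.prod_eq_zero (Finset.mem_univ 3) ?_
    simp [hs.symm]
  · simp

theorem traceTerm_hasRankLE : HasRankLE traceTerm 7 := by
  refine .of_fintype (κ := Option (Fin 6))
    (fun q => ![fun x => if x.1 = x.2 then 1 else 0, fun x => if x.1 = x.2 then 1 else 0,
      fun x => q.elim (if x.1 = x.2 then 1 else 0) fun p => strassenFst p x.1 x.2,
      fun x => q.elim (if x.1 = x.2 then 1 else 0) fun p => strassenSnd p x.1 x.2,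
      fun x => q.elim (if x.1 = x.2 then 1 else 0)
        fun p => strassenRow p x.1 * strassenCol p x.2]) (by simp) fun a => ?_
  rw [traceTerm, strassen_decomposition, Fintype.sum_option, mul_add, add_comm, Finset.mul_sum]
  refine congrArg₂ _ ?_ (Finset.sum_congr rfl fun p _ => ?_) <;>
  simp [Fin.prod_univ_five, mul_assoc]

/-- A label in `Fin 4` encodes a pair of labels in `Fin 2`. -/
def labelEquiv : Fin 2 × Fin 2 ≃ Fin 4 := finProdFinEquiv

/-- The Kronecker product of a split rank-one product with `tr A * tr B * tr (C D E)` is, up to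
linear substitutions in the factors, the tensor of the multiplication of a `2 × 4` by a `4 × 4`
matrix: the outer labels of `C` and `E` are contracted with fixed vectors in the first factor and
with each other in the second. -/
theorem splitTerm_mul_traceTerm_hasRankLE (p : Fin 6) :
    HasRankLE (fun a : Fin 5 → (Fin 2 × Fin 2) × (Fin 2 × Fin 2) =>
      splitTerm p (fun v => (a v).1) * traceTerm (fun v => (a v).2)) 26 := by
  refine ⟨fun q => ![fun z => strassenFst p z.1.1 z.1.2 * (if z.2.1 = z.2.2 then 1 else 0),
    fun z => strassenSnd p z.1.1 z.1.2 * (if z.2.1 = z.2.2 then 1 else 0),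
    fun z => strassenRow p z.1.1 * rectMulFst q z.2.1 (labelEquiv (z.1.2, z.2.2)),
    fun z => rectMulSnd q (labelEquiv (z.1.1, z.2.1)) (labelEquiv (z.1.2, z.2.2)),
    fun z => rectMulTrd q (labelEquiv (z.1.1, z.2.1)) z.2.2 * strassenCol p z.1.2], fun a => ?_⟩
  have h := rectMul_decomposition (a 2).2.1 (a 4).2.2 (labelEquiv ((a 2).1.2, (a 2).2.2))
    (labelEquiv ((a 3).1.1, (a 3).2.1)) (labelEquiv ((a 3).1.2, (a 3).2.2))
    (labelEquiv ((a 4).1.1, (a 4).2.1))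
  simp only [labelEquiv.apply_eq_iff_eq, Prod.mk.injEq] at h
  have hand (P Q : Prop) [Decidable P] [Decidable Q] :
      (if P ∧ Q then 1 else 0 : ℤ) = (if P then 1 else 0) * (if Q then 1 else 0) := by
    split_ifs <;> simp_all
  rw [hand, hand] at h
  have h' := congrArg ((strassenFst p (a 0).1.1 (a 0).1.2 *
    (if (a 0).2.1 = (a 0).2.2 then 1 else 0) * (strassenSnd p (a 1).1.1 (a 1).1.2 *
    (if (a 1).2.1 = (a 1).2.2 then 1 else 0)) * strassenRow p (a 2).1.1 *
    strassenCol p (a 4).1.2) * ·) h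
  simp only [Finset.mul_sum] at h'
  refine Eq.trans ?_ (h'.trans (Finset.sum_congr rfl fun q _ => ?_))
  · simp only [splitTerm, traceTerm]
    ring
  · simp only [Fin.prod_univ_five, Matrix.cons_val]
    ring

theorem cycleArray_four_hasRankLE : HasRankLE (cycleArray (Fin 4) ℤ) 937 := by
  let L := labelEquiv.symm
  have hP : HasRankLE (fun a => ∑ p, splitTerm p a) 24 := .sum splitTerm_hasRankLE
  have hPQ := HasRankLE.sum splitTerm_mul_traceTerm_hasRankLE
  have hQP := hPQ.comp (Prod.swap (α := Fin 2 × Fin 2) (β := Fin 2 × Fin 2))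
  have h := (((hP.mul hP).add hPQ).add hQP).add (traceTerm_hasRankLE.mul traceTerm_hasRankLE)
  have h' := h.comp fun x : Fin 4 × Fin 4 => (((L x.1).1, (L x.2).1), ((L x.1).2, (L x.2).2))
  norm_num only [Fintype.card_fin] at h'
  convert h' using 2 with a
  rw [← cycleArray_comp L, cycleArray_prod, cycleArray_two_eq, cycleArray_two_eq]
  simp only [Prod.fst_swap, Prod.snd_swap, ← Finset.sum_mul]
  ring

/-! ### Border rank of the five-cycle with two labels -/

/-- The factors of five simple arrays on the five-cycle; all their cyclic rotations occur in
`borderArray`. -/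
def borderOrbit : Fin 5 → Fin 5 → Matrix (Fin 2) (Fin 2) ℤ :=
  ![![!![0, 0; 0, 1], !![0, 0; 1, 0], !![-1, 1; 1, 0], !![0, 1; 1, 0], !![0, 1; 1, -1]],
    ![!![0, 0; 1, 0], !![0, 1; 0, 0], !![0, 1; 0, 1], !![0, 0; 0, 1], !![0, 0; 0, 1]],
    ![!![0, 1; 0, 1], !![0, 0; 1, 0], !![1, 0; 0, 0], !![1, 0; 0, 0], !![1, 1; 0, 0]],
    ![!![-1, 1; 0, 0], !![0, 1; 2, 0], !![0, 1; 0, 0], !![0, 0; 1, 0], !![1, 0; 0, 0]],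
    ![!![-1, 1; 1, 0], !![0, 1; 0, 0], !![0, 1; 1, 0], !![0, 1; 0, -1], !![0, 0; 1, 0]]]

/-- The four matrices whose fifth tensor powers occur in `borderArray`. -/
def borderFixed : Fin 4 → Matrix (Fin 2) (Fin 2) ℤ :=
  ![!![1, 0; 0, 0], !![0, 0; 0, 1], !![0, 1; 0, 0], !![0, -1; -1, 0]]

/-- The sum of the `25` rotated simple arrays of `borderOrbit` and the `4` fifth powers of
`borderFixed`. It agrees with `cycleArray` at all positions of nonpositive torus weight.

In terms of the matrix units `x = E₀₀`, `n = E₀₁`, `m = E₁₀`, `y = E₁₁`, the constant closed walks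
are the powers of `x` and `y`, and the other `30` closed walks fall into six rotation classes, which
are obtained from the lower order terms of the five orbits. The unwanted words with more `n` than
`m` cancel between the orbits, and against `n ^ 5 - (n + m) ^ 5` for those with four `n` and one `m`
and those with three `n` and two `m`. -/
def borderArray (a : Fin 5 → Fin 2 × Fin 2) : ℤ :=
  (∑ s, ∑ o, ∏ v, borderOrbit o v (a (v + s)).1 (a (v + s)).2) +
    ∑ o, ∏ v, borderFixed o (a v).1 (a v).2

/-- The exponent of `ε` by which the one-parameter torus scales the matrix unit at position `x`:
`E₀₁` by `ε⁻¹`, `E₁₀` by `ε`, the diagonal units by `1`. -/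
def torusWeight (x : Fin 2 × Fin 2) : ℤ := x.1 - x.2

theorem borderArray_hasRankLE : HasRankLE borderArray 29 := by
  refine .of_fintype (κ := (Fin 5 × Fin 5) ⊕ Fin 4)
    (Sum.elim (fun p v x => borderOrbit p.2 (v - p.1) x.1 x.2)
      fun o _ x => borderFixed o x.1 x.2) (by simp) fun a => ?_
  rw [Fintype.sum_sum_type, Fintype.sum_prod_type]
  refine congrArg₂ _ (Finset.sum_congr rfl fun s _ => Finset.sum_congr rfl fun o _ => ?_) rfl
  exact Fintype.prod_equiv (Equiv.addRight s) _ _ fun v => by simp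

/-- The finite check behind `borderArray_eq`. The sum over an orbit is grouped by rotations, so
that the same five-fold products recur and are evaluated once. -/
theorem borderArray_eq_of_positions :
    let f (a₀ a₁ a₂ a₃ a₄ : Fin 2 × Fin 2) : ℤ :=
      ∑ o, borderOrbit o 0 a₀.1 a₀.2 * borderOrbit o 1 a₁.1 a₁.2 * borderOrbit o 2 a₂.1 a₂.2 *
        borderOrbit o 3 a₃.1 a₃.2 * borderOrbit o 4 a₄.1 a₄.2
    ∀ a₀ a₁ a₂ a₃ a₄ : Fin 2 × Fin 2,
      torusWeight a₀ + torusWeight a₁ + torusWeight a₂ + torusWeight a₃ + torusWeight a₄ ≤ 0 →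
      f a₀ a₁ a₂ a₃ a₄ + f a₁ a₂ a₃ a₄ a₀ + f a₂ a₃ a₄ a₀ a₁ + f a₃ a₄ a₀ a₁ a₂ + f a₄ a₀ a₁ a₂ a₃ +
        ∑ o, borderFixed o a₀.1 a₀.2 * borderFixed o a₁.1 a₁.2 * borderFixed o a₂.1 a₂.2 *
          borderFixed o a₃.1 a₃.2 * borderFixed o a₄.1 a₄.2 =
      (if a₀.2 = a₁.1 then 1 else 0) * (if a₁.2 = a₂.1 then 1 else 0) *
        (if a₂.2 = a₃.1 then 1 else 0) * (if a₃.2 = a₄.1 then 1 else 0) *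
        (if a₄.2 = a₀.1 then 1 else 0) := by
  decide +kernel

theorem borderArray_eq (a : Fin 5 → Fin 2 × Fin 2) (ha : ∑ v, torusWeight (a v) ≤ 0) :
    borderArray a = cycleArray (Fin 2) ℤ a := by
  rw [Fin.sum_univ_five] at ha
  have h := borderArray_eq_of_positions (a 0) (a 1) (a 2) (a 3) (a 4) ha
  rw [borderArray, cycleArray]
  simp only [Fin.prod_univ_five]
  exact (congrArg₂ _ (Fin.sum_univ_five _) rfl).trans h

/-- Around a closed walk the torus weights telescope. -/
theorem sum_torusWeight_eq_zero {a : Fin 5 → Fin 2 × Fin 2} (ha : cycleArray (Fin 2) ℤ a ≠ 0) :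
    ∑ v, torusWeight (a v) = 0 := by
  have h (v : Fin 5) : (a v).2 = (a (v + 1)).1 := by
    by_contra hv
    exact ha (Finset.prod_eq_zero (Finset.mem_univ v) (if_neg hv))
  simp only [torusWeight, Finset.sum_sub_distrib, h, sub_eq_zero]
  exact (Equiv.sum_comp (Equiv.addRight (1 : Fin 5)) fun v => (((a v).1 : ℕ) : ℤ)).symm

theorem intCast_cycleArray (X : Type*) [DecidableEq X] (a : Fin 5 → X × X) :
    ((cycleArray X ℤ a : ℤ) : ℂ) = cycleArray X ℂ a := by
  simp [cycleArray]

/-- Scaling `borderArray` by the torus with parameter `1 / (k + 1)` preserves the rank, fixes the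
entries of `cycleArray`, and drives the entries of positive weight to `0`. -/
theorem cycleArray_two_hasBorderRankLE : HasBorderRankLE (cycleArray (Fin 2) ℂ) 29 := by
  let ε (k : ℕ) : ℂ := 1 / ((k : ℂ) + 1)
  have hε (k : ℕ) : ε k ≠ 0 := one_div_ne_zero (Nat.cast_add_one_ne_zero k)
  refine ⟨fun k a => (∏ v, ε k ^ torusWeight (a v)) * (borderArray a : ℂ), fun k =>
    (borderArray_hasRankLE.map (Int.castRingHom ℂ)).prod_mul fun x => ε k ^ torusWeight x,
    fun a => ?_⟩
  have hprod (k : ℕ) : ∏ v, ε k ^ torusWeight (a v) = ε k ^ ∑ v, torusWeight (a v) := by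
    simp only [Fin.prod_univ_five, Fin.sum_univ_five, zpow_add₀ (hε k)]
  simp only [hprod, ← intCast_cycleArray]
  rcases le_or_gt (∑ v, torusWeight (a v)) 0 with hle | hpos
  · rw [borderArray_eq a hle]
    by_cases h0 : cycleArray (Fin 2) ℤ a = 0
    · simp [h0]
    · simp [sum_torusWeight_eq_zero h0]
  · have h0 : cycleArray (Fin 2) ℤ a = 0 := by
      by_contra h0
      exact hpos.ne' (sum_torusWeight_eq_zero h0)
    obtain ⟨d, hd⟩ := Int.eq_ofNat_of_zero_le hpos.le
    have hd0 : d ≠ 0 := by rintro rfl; simp [hd] at hpos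
    have hlim : Tendsto ε atTop (𝓝 0) := tendsto_one_div_add_atTop_nhds_zero_nat
    simpa [h0, hd, hd0] using (hlim.pow d).mul_const (borderArray a : ℂ)

/-! ### The bounds for four labels -/

theorem HasRankLE.cycleArray_intCast {X : Type*} [DecidableEq X] {r : ℕ}
    (h : HasRankLE (cycleArray X ℤ) r) : HasRankLE (cycleArray X ℂ) r := by
  have h' := h.map (Int.castRingHom ℂ)
  simpa only [Int.coe_castRingHom, intCast_cycleArray] using h'

theorem cycleArray_four_hasBorderRankLE : HasBorderRankLE (cycleArray (Fin 4) ℂ) (29 * 29) := by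
  let L := labelEquiv.symm
  have h := (cycleArray_two_hasBorderRankLE.mul cycleArray_two_hasBorderRankLE).comp
    fun x : Fin 4 × Fin 4 => (((L x.1).1, (L x.2).1), ((L x.1).2, (L x.2).2))
  convert h using 2 with a
  rw [← cycleArray_comp L, cycleArray_prod]

theorem proposition3p3 :
    (tensorRank (graphTensor (SimpleGraph.cycleGraph 5) 4) ≤ 937 ∧ (937 : ℕ) < 31 ^ 2) ∧
      tensorBorderRank (graphTensor (SimpleGraph.cycleGraph 5) 4) ≤ 910 := by
  rw [graphTensor_cycleGraph_five]
  refine ⟨⟨?_, by norm_num⟩, ?_⟩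
  · exact cycleArray_four_hasRankLE.cycleArray_intCast.tensorRank_le _
  · refine (cycleArray_four_hasBorderRankLE.tensorBorderRank_le _).trans ?_
    exact_mod_cast (by norm_num : 29 * 29 ≤ 910)
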